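/- Let $\mathbb N=\{0,1,2,\ldots\}$. For an integer $k\ge 3$ and $x\in\mathbb Z$ put $p_k(x)=\frac{(k-2)x^2-(k-4)x}{2}$. (The values with $x\in\mathbb N$ are the $k$-gonal numbers; the values with $x\in\mathbb Z$ are the generalized $k$-gonal numbers.) Then the following hold. (i) $\{p_5(x_1)+p_5(x_2)+p_5(x_3)+3p_5(x_4):\ x_1,x_2,x_3,x_4\in\mathbb N\}=\mathbb N\setminus\{19\}$. (ii) $\{p_6(x_1)+p_6(x_2)+p_6(x_3)+3p_6(x_4):\ x_1,x_2,x_3,x_4\in\mathbb N\}=\mathbb N\setminus\{14,23,41,42,83\}$. (iii) $\{p_7(x_1)+p_7(x_2)+p_7(x_3)+3p_7(x_4):\ x_1,x_2,x_3,x_4\in\mathbb N\}=\mathbb N\setminus\{13,16,27,31,33,49,50,67,87,178,181,259\}$. (iv) For each $k\in\{8,9,10\}$, every integer $n>M_k$ can be written as $n=p_k(x_1)+p_k(x_2)+p_k(x_3)+3p_k(x_4)$ with $x_1,x_2,x_3,x_4\in\mathbb N$, where $M_8=435$, $M_9=695$ and $M_{10}=916$. (v) $\{p_7(w)+p_7(x)+p_7(y)+3p_7(z):\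 w\in\mathbb Z,\ x,y,z\in\mathbb N\}=\mathbb N$. (vi) $\{p_9(x_1)+p_9(x_2)+p_9(x_3)+3p_9(x_4):\ x_1,x_2,x_3,x_4\in\mathbb Z\}=\mathbb N\setminus\{17\}$. (vii) $\{p_{10}(x_1)+p_{10}(x_2)+p_{10}(x_3)+3p_{10}(x_4):\ x_1,x_2,x_3,x_4\in\mathbb Z\}=\mathbb N\setminus\{16,19\}$. -/

import Mathlib

/-- The polygonal number `p_k(x) = ((k - 2) x² - (k - 4) x) / 2` of order `k` at an integer `x`
(for `x ≥ 0` the ordinary, for `x : ℤ` the generalized `k`-gonal numbers). The division by `2`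
is exact, see `two_mul_polygonalNumber`. -/
def polygonalNumber (k : ℕ) (x : ℤ) : ℤ :=
  (((k : ℤ) - 2) * x ^ 2 - ((k : ℤ) - 4) * x) / 2

theorem two_mul_polygonalNumber (k : ℕ) (x : ℤ) :
    2 * polygonalNumber k x = ((k : ℤ) - 2) * x ^ 2 - ((k : ℤ) - 4) * x := by
  unfold polygonalNumber
  refine Int.mul_ediv_cancel' ?_
  obtain ⟨c, hc⟩ := (Int.even_mul_pred_self x).two_dvd
  exact ⟨((k : ℤ) - 2) * c + x, by linear_combination ((k : ℤ) - 2) * hc⟩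

/-- On natural numbers, `p_{m+2}(n) = m * (n choose 2) + n`. -/
theorem polygonalNumber_natCast (m n : ℕ) :
    polygonalNumber (m + 2) (n : ℤ) = (m : ℤ) * (n.choose 2 : ℤ) + n := by
  have h2 : ((n.choose 2 : ℕ) : ℤ) * 2 = n * (n - 1) := by
    induction n with
    | zero => simp
    | succ d ih =>
      rw [Nat.choose_succ_succ' d 1, Nat.choose_one_right]
      push_cast
      linear_combination ih
  have h := two_mul_polygonalNumber (m + 2) n
  push_cast at h
  refine mul_left_cancel₀ (two_ne_zero (α := ℤ)) ?_
  linear_combination h - (m : ℤ) * h2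

/-! Put m = k - 2, a = x₁² + x₂² + x₃² + 3x₄² and b = x₁ + x₂ + x₃ + 3x₄. A value n of the sum
satisfies 2n = m(a - b) + 2b, so, as in Cauchy's proof of the polygonal number theorem, n must be
split into a pair (a, b) that some natural xᵢ realize.

By the Lagrange identity, 6a - b² = w² + 4(p² + pq + q²), where w = 6x₄ - b and p, q are differences
of x₁, x₂, x₃. Integer xᵢ therefore come from representing 6a - b² by a ternary form
(`exists_int_sum_sq_eq_and_sum_eq`). Legendre's theorem with an auxiliary Dirichlet prime represents
it rationally, and Davenport–Cassels descent makes the representation integral. If 5a ≤ b² + 2b,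
Cauchy–Schwarz forces xᵢ ≥ 0 (`exists_nat_sum_sq_eq_and_sum_eq`).

Suitable (a, b) exist for every n ≥ 60000 (`exists_cauchy_parameters`). Smaller n are settled by
computing sumsets as bit masks in the kernel. -/

/-! ### Legendre's theorem by the pigeonhole principle -/

theorem not_isSquare_of_mod_four_eq_three {A : ℕ} (hA : A % 4 = 3) : ¬ IsSquare A := by
  rintro ⟨r, rfl⟩
  have h : r % 4 = 0 ∨ r % 4 = 1 ∨ r % 4 = 2 ∨ r % 4 = 3 := by omega
  rcases h with h | h | h | h <;> simp [Nat.mul_mod, h] at hA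

/-- A special case of Legendre's theorem on ternary quadratic forms. -/
theorem exists_sq_add_mul_sq_eq_mul_sq {A B : ℕ} (hB : 0 < B) (hA : A % 4 = 3)
    (hcop : A.Coprime B) {α β : ℤ} (hα : (B : ℤ) ∣ α ^ 2 + A) (hβ : (A : ℤ) ∣ β ^ 2 - B) :
    ∃ x s t : ℤ, t ≠ 0 ∧ x ^ 2 + A * s ^ 2 = B * t ^ 2 := by
  have hA0 : 0 < A := by omega
  have : NeZero A := ⟨hA0.ne'⟩
  have : NeZero B := ⟨hB.ne'⟩
  have hAns := not_isSquare_of_mod_four_eq_three hA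
  have hABns : ¬ IsSquare (A * B) := by
    rintro ⟨r, hr⟩
    obtain ⟨d, hd⟩ := exists_eq_pow_of_mul_eq_pow (Nat.isUnit_iff.mpr hcop)
      (hr.trans (sq r).symm)
    exact hAns ⟨d, hd.trans (sq d)⟩
  let S : Finset (ℕ × ℕ × ℕ) := Finset.range (Nat.sqrt (A * B) + 1) ×ˢ
    Finset.range (Nat.sqrt B + 1) ×ˢ Finset.range (Nat.sqrt A + 1)
  let f : ℕ × ℕ × ℕ → ZMod B × ZMod A := fun v =>
    ((v.1 : ZMod B) - (α : ZMod B) * v.2.1, (v.1 : ZMod A) - (β : ZMod A) * v.2.2)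
  -- The box has more than √(AB)·√B·√A = AB points, so two of them agree in x - αs mod B and in x -
  -- βt mod A.
  have hcard : (Finset.univ : Finset (ZMod B × ZMod A)).card < S.card := by
    simp only [S, Finset.card_univ, Fintype.card_prod, ZMod.card, Finset.card_product,
      Finset.card_range]
    have h1 := Nat.lt_succ_sqrt' (A * B)
    have h2 := Nat.lt_succ_sqrt' B
    have h3 := Nat.lt_succ_sqrt' A
    simp only [Nat.succ_eq_add_one] at h1 h2 h3
    have h4 : (B * A) ^ 2 <
        ((Nat.sqrt (A * B) + 1) * ((Nat.sqrt B + 1) * (Nat.sqrt A + 1))) ^ 2 := by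
      calc (B * A) ^ 2 = (A * B) * (B * A) := by ring
        _ < (Nat.sqrt (A * B) + 1) ^ 2 * ((Nat.sqrt B + 1) ^ 2 * (Nat.sqrt A + 1) ^ 2) := by
            gcongr
        _ = _ := by ring
    exact lt_of_pow_lt_pow_left₀ 2 (Nat.zero_le _) h4
  obtain ⟨⟨x₁, s₁, t₁⟩, h₁, ⟨x₂, s₂, t₂⟩, h₂, hne, heq⟩ :=
    Finset.exists_ne_map_eq_of_card_lt_of_maps_to hcard (f := f) (fun _ _ => Finset.mem_univ _)
  simp only [S, Finset.mem_product, Finset.mem_range, Nat.lt_succ_iff] at h₁ h₂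
  have hbound : ∀ {N u v : ℕ}, u ≤ Nat.sqrt N → v ≤ Nat.sqrt N →
      ((u : ℤ) - v) ^ 2 ≤ N := by
    intro N u v hu hv
    have h := Nat.sqrt_le' N
    have h' : ((Nat.sqrt N : ℕ) : ℤ) ^ 2 ≤ N := by exact_mod_cast h
    refine le_trans (sq_le_sq' ?_ ?_) h' <;> omega
  set x : ℤ := (x₁ : ℤ) - x₂ with hx
  set s : ℤ := (s₁ : ℤ) - s₂ with hs
  set t : ℤ := (t₁ : ℤ) - t₂ with ht
  have hxb : x ^ 2 ≤ ((A * B : ℕ) : ℤ) := hbound h₁.1 h₂.1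
  have hsb : s ^ 2 ≤ B := hbound h₁.2.1 h₂.2.1
  have htb : t ^ 2 ≤ A := hbound h₁.2.2 h₂.2.2
  -- Strictness, from A and AB not being squares, leaves only the multiples 0 and AB for x² + As² -
  -- Bt².
  have hxb' : x ^ 2 < ((A * B : ℕ) : ℤ) := by
    refine lt_of_le_of_ne hxb fun h => hABns ⟨x.natAbs, ?_⟩
    zify
    rw [← sq, sq_abs, h]; push_cast; ring
  have htb' : t ^ 2 < A := by
    refine lt_of_le_of_ne htb fun h => hAns ⟨t.natAbs, ?_⟩
    zify
    rw [← sq, sq_abs, h]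
  simp only [f, Prod.mk.injEq] at heq
  have hdB : (B : ℤ) ∣ x - α * s := by
    rw [← ZMod.intCast_zmod_eq_zero_iff_dvd]
    rw [hx, hs]; push_cast
    linear_combination heq.1
  have hdA : (A : ℤ) ∣ x - β * t := by
    rw [← ZMod.intCast_zmod_eq_zero_iff_dvd]
    rw [hx, ht]; push_cast
    linear_combination heq.2
  have h1 : (B : ℤ) ∣ x ^ 2 + A * s ^ 2 - B * t ^ 2 := by
    have : x ^ 2 + A * s ^ 2 - B * t ^ 2 =
        (x - α * s) * (x + α * s) + (α ^ 2 + A) * s ^ 2 - B * t ^ 2 := by ring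
    rw [this]
    exact ((hdB.mul_right _).add (hα.mul_right _)).sub (dvd_mul_right _ _)
  have h2 : (A : ℤ) ∣ x ^ 2 + A * s ^ 2 - B * t ^ 2 := by
    have : x ^ 2 + A * s ^ 2 - B * t ^ 2 =
        (x - β * t) * (x + β * t) + (β ^ 2 - B) * t ^ 2 + A * s ^ 2 := by ring
    rw [this]
    exact ((hdA.mul_right _).add (hβ.mul_right _)).add (dvd_mul_right _ _)
  obtain ⟨c, hc⟩ := (Nat.isCoprime_iff_coprime.mpr hcop).mul_dvd h2 h1
  have hA0' : (0 : ℤ) < A := by exact_mod_cast hA0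
  have hB0' : (0 : ℤ) < B := by exact_mod_cast hB
  have hAB : (0 : ℤ) < A * B := mul_pos hA0' hB0'
  push_cast at hxb'
  have hc1 : -1 < c := by
    by_contra hcon
    have : (A : ℤ) * B * c ≤ A * B * (-1) := by gcongr; omega
    nlinarith [sq_nonneg x, sq_nonneg s]
  have hc2 : c < 2 := by
    by_contra hcon
    have : (A : ℤ) * B * 2 ≤ A * B * c := by gcongr; omega
    nlinarith [sq_nonneg t]
  have hc3 : c = 0 ∨ c = 1 := by omega
  rcases hc3 with rfl | rfl
  · refine ⟨x, s, t, fun ht0 => hne ?_, by linarith⟩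
    rw [ht0] at hc
    have hc' : x ^ 2 + A * s ^ 2 = 0 := by linear_combination hc
    have hs0 : s = 0 := by
      by_contra hcon
      linarith [sq_nonneg x, mul_pos hA0' (sq_pos_of_ne_zero hcon)]
    have hx0 : x = 0 := by
      rw [hs0] at hc'
      exact pow_eq_zero_iff (two_ne_zero) |>.mp (by linear_combination hc' : x ^ 2 = 0)
    ext <;> simp <;> omega
  -- Here x² + As² = B(t² + A). Multiply by t² + A and use that norms x² + Ay² are multiplicative.
  · refine ⟨x * t + A * s, x - s * t, t ^ 2 + A, by positivity, ?_⟩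
    linear_combination (t ^ 2 + A) * hc

/-! ### Davenport–Cassels descent for w² + p² + pq + q² -/

/-- The rounding step in the Davenport–Cassels argument. -/
theorem Int.exists_two_mul_abs_sub_mul_le (w : ℤ) {t : ℤ} (ht : 0 < t) :
    ∃ y : ℤ, -t ≤ 2 * (w - t * y) ∧ 2 * (w - t * y) ≤ t := by
  refine ⟨(2 * w + t) / (2 * t), ?_, ?_⟩
  · have := Int.mul_ediv_self_le (x := 2 * w + t) (k := 2 * t) (by omega)
    linarith
  · have := Int.lt_mul_ediv_self_add (x := 2 * w + t) (k := 2 * t) (by omega)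
    linarith

/-- The form `w² + p² + pq + q²` represents integrally what it represents rationally. -/
theorem exists_eq_of_mul_sq_eq {D : ℤ} (n : ℕ) (hn : 0 < n) (w p q : ℤ)
    (h : D * (n : ℤ) ^ 2 = w ^ 2 + (p ^ 2 + p * q + q ^ 2)) :
    ∃ w p q : ℤ, D = w ^ 2 + (p ^ 2 + p * q + q ^ 2) := by
  induction n using Nat.strong_induction_on generalizing w p q with
  | _ n ih =>
    obtain ⟨t, ht⟩ : ∃ t : ℤ, t = n := ⟨_, rfl⟩
    have ht0 : 0 < t := by omega
    rw [← ht] at h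
    obtain ⟨y, hy1, hy2⟩ := Int.exists_two_mul_abs_sub_mul_le w ht0
    obtain ⟨v, hv1, hv2⟩ := Int.exists_two_mul_abs_sub_mul_le q ht0
    -- Completing the square, p² + pq + q² = ((2p + q)² + 3q²)/4, so q is rounded first and then 2p
    -- + q', with modulus 2t.
    obtain ⟨u, hu1, hu2⟩ := Int.exists_two_mul_abs_sub_mul_le (2 * p + (q - t * v))
      (t := 2 * t) (by omega)
    set w' := w - t * y with hw'
    set p' := p - t * u with hp'
    set q' := q - t * v with hq'
    set F := w' ^ 2 + (p' ^ 2 + p' * q' + q' ^ 2) with hF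
    -- The rounding gives F ≤ (1/4 + 1/4 + 3/16)t² = (11/16)t².
    have hFlt : F < t * t := by
      have e1 : (2 * w') ^ 2 ≤ t ^ 2 := sq_le_sq' hy1 hy2
      have e2 : (2 * q') ^ 2 ≤ t ^ 2 := sq_le_sq' hv1 hv2
      have e3 : (2 * p' + q') ^ 2 ≤ t ^ 2 := by
        apply sq_le_sq' <;> rw [hp'] <;> linarith
      nlinarith
    have hF0 : 0 ≤ F := by
      nlinarith [sq_nonneg w', sq_nonneg (2 * p' + q'), sq_nonneg q']
    set b := 2 * D * t - (2 * w * y + 2 * p * u + p * v + q * u + 2 * q * v) with hb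
    set a := y ^ 2 + (u ^ 2 + u * v + v ^ 2) - D with ha
    have hFt : F = t * (a * t + b) := by
      rw [hF, ha, hb, hw', hp', hq']
      linear_combination -h
    have hlt : a * t + b < t := by
      rw [hFt] at hFlt
      exact lt_of_mul_lt_mul_left hFlt ht0.le
    have hge : 0 ≤ a * t + b := by
      rw [hFt] at hF0
      exact nonneg_of_mul_nonneg_right hF0 ht0
    rcases hge.eq_or_lt with h0 | h0
    · rw [← h0, mul_zero] at hFt
      have hw0 : w' = 0 := by
        have : w' ^ 2 ≤ 0 := by nlinarith [sq_nonneg (2 * p' + q'), sq_nonneg q']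
        exact pow_eq_zero_iff two_ne_zero |>.mp (le_antisymm this (sq_nonneg _))
      have hq0 : q' = 0 := by
        have : q' ^ 2 ≤ 0 := by nlinarith [sq_nonneg (2 * p' + q'), sq_nonneg w']
        exact pow_eq_zero_iff two_ne_zero |>.mp (le_antisymm this (sq_nonneg _))
      have hp0 : p' = 0 := by
        rw [hF, hw0, hq0] at hFt
        exact pow_eq_zero_iff two_ne_zero |>.mp (by linarith : p' ^ 2 = 0)
      refine ⟨y, u, v, ?_⟩
      have e1 : w = t * y := by linarith
      have e2 : p = t * u := by linarith
      have e3 : q = t * v := by linarith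
      rw [e1, e2, e3] at h
      refine mul_right_cancel₀ (pow_ne_zero 2 ht0.ne') (h.trans ?_)
      ring
    · obtain ⟨n', hn'⟩ := Int.eq_ofNat_of_zero_le hge
      -- The line through (w, p, q)/t and the lattice point (y, u, v) meets the quadric again at a
      -- point of denominator F/t = at + b < t.
      refine ih n' (by omega) (by omega) (a * w + b * y) (a * p + b * u) (a * q + b * v) ?_
      rw [← hn']
      linear_combination a ^ 2 * h + a * b * hb - b ^ 2 * ha

/-! ### Representing integers through auxiliary primes -/

theorem exists_dvd_sq_sub_of_jacobiSym_eq_one {l : ℕ} (hl : l.Prime) {a : ℤ}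
    (h : jacobiSym a l = 1) : ∃ β : ℤ, (l : ℤ) ∣ β ^ 2 - a := by
  have : Fact l.Prime := ⟨hl⟩
  rw [← jacobiSym.legendreSym.to_jacobiSym] at h
  have h0 : (a : ZMod l) ≠ 0 := by
    intro h0
    rw [(legendreSym.eq_zero_iff l a).mpr h0] at h
    exact absurd h (by norm_num)
  obtain ⟨r, hr⟩ := (legendreSym.eq_one_iff l h0).mp h
  obtain ⟨β, rfl⟩ := ZMod.intCast_surjective r
  refine ⟨β, ?_⟩
  rw [← ZMod.intCast_zmod_eq_zero_iff_dvd]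
  push_cast
  rw [hr]; ring

/-- The symbol (D/N) depends only on N mod 4D, so N may be replaced by 4D - 1, modulo which 4D ≡ 1.
This needs no factorization of D. -/
theorem jacobiSym_eq_one_of_mod_four_mul {D N : ℕ} (hD : 0 < D)
    (hN : (N + 1) % (4 * D) = 0) : jacobiSym D N = 1 := by
  have hmod : N % (4 * D) = 4 * D - 1 := by
    obtain ⟨k, hk⟩ := Nat.dvd_of_mod_eq_zero hN
    obtain ⟨j, rfl⟩ : ∃ j, k = j + 1 := ⟨k - 1, by
      rcases k with _ | k
      · omega
      · omega⟩
    have : N = (4 * D - 1) + 4 * D * j := by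
      rw [mul_add] at hk; omega
    rw [this, Nat.add_mul_mod_self_left, Nat.mod_eq_of_lt (by omega)]
  have hodd : Odd N := by
    have : (N + 1) % 4 = 0 := Nat.mod_eq_zero_of_dvd
      ((dvd_mul_right 4 D).trans (Nat.dvd_of_mod_eq_zero hN))
    exact Nat.odd_iff.mpr (by omega)
  rw [jacobiSym.mod_right' D hodd, hmod]
  have hodd' : Nat.Coprime 2 (4 * D - 1) := by
    rw [Nat.coprime_two_left]
    exact Nat.odd_iff.mpr (by omega)
  have h4 : jacobiSym ((2 : ℤ) ^ 2) (4 * D - 1) = 1 :=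
    jacobiSym.sq_one' (by exact_mod_cast hodd')
  have h1 : jacobiSym ((2 : ℤ) ^ 2 * D) (4 * D - 1) = 1 := by
    rw [jacobiSym.mod_left' (a₂ := 1), jacobiSym.one_left]
    have : ((4 * D - 1 : ℕ) : ℤ) = 4 * D - 1 := by omega
    rw [this]
    have : ((2 : ℤ) ^ 2 * D) = 1 + (4 * D - 1) := by ring
    rw [this, Int.add_emod_right]
  rwa [jacobiSym.mul_left, h4, one_mul] at h1

theorem exists_sq_add_three_mul_sq_eq_prime_mul_sq {l : ℕ} (hl : l.Prime) (h3 : l % 3 = 1) :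
    ∃ x s t : ℤ, t ≠ 0 ∧ x ^ 2 + 3 * s ^ 2 = l * t ^ 2 := by
  have hl2 : l ≠ 2 := by rintro rfl; omega
  have hodd : Odd l := hl.odd_of_ne_two hl2
  have hj : jacobiSym (-3) l = 1 := by
    have h : jacobiSym l 3 = 1 := by
      rw [jacobiSym.mod_left' (a₂ := 1), jacobiSym.one_left]
      omega
    have : ((-3 : ℤ)) = -((3 : ℕ) : ℤ) := by norm_num
    rw [this, jacobiSym.neg _ hodd]
    rcases (by have := Nat.odd_iff.mp hodd; omega : l % 4 = 1 ∨ l % 4 = 3) with h4 | h4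
    · rw [ZMod.χ₄_nat_one_mod_four h4, one_mul,
        jacobiSym.quadratic_reciprocity_one_mod_four' (by decide) h4, h]
    · rw [ZMod.χ₄_nat_three_mod_four h4,
        jacobiSym.quadratic_reciprocity_three_mod_four (by norm_num) h4, h]
      norm_num
  obtain ⟨α, hα⟩ := exists_dvd_sq_sub_of_jacobiSym_eq_one hl hj
  have hcop : Nat.Coprime 3 l := by
    rw [Nat.coprime_primes Nat.prime_three hl]
    rintro rfl; omega
  obtain ⟨x, s, t, ht, h⟩ := exists_sq_add_mul_sq_eq_mul_sq (A := 3) (B := l) hl.pos (by norm_num)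
    hcop (α := α) (β := 1) (by simpa using hα) (by push_cast; omega)
  exact ⟨x, s, t, ht, by exact_mod_cast h⟩

theorem exists_eq_of_mul_sq_eq_sq_add_sq_add_three_mul_sq {D x y z t : ℤ} (ht : t ≠ 0)
    (h : D * t ^ 2 = x ^ 2 + y ^ 2 + 3 * z ^ 2) :
    ∃ w p q : ℤ, D = w ^ 2 + (p ^ 2 + p * q + q ^ 2) := by
  refine exists_eq_of_mul_sq_eq t.natAbs (Int.natAbs_pos.mpr ht) x (y - z) (2 * z) ?_
  rw [Int.natCast_natAbs, sq_abs]
  linear_combination h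

/-- Take a prime l ≡ 8D² - 1 mod 12D. Then l ≡ -1 mod 4D makes x² + ls² = Dt² solvable, and l ≡ 1
mod 3 (as D² ≡ 1) makes l rationally of the form y² + 3z². Substitution represents D rationally by
x² + y² + 3z², which is rationally equivalent to the target form. -/
theorem exists_eq_of_mod_three_ne_zero {D : ℕ} (hD : D % 3 ≠ 0) :
    ∃ w p q : ℤ, (D : ℤ) = w ^ 2 + (p ^ 2 + p * q + q ^ 2) := by
  have hD0 : 0 < D := by omega
  have hcop : IsCoprime (8 * (D : ℤ) ^ 2 - 1) ((12 * D : ℕ) : ℤ) := by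
    have h4D : IsCoprime (8 * (D : ℤ) ^ 2 - 1) (4 * (D : ℤ)) := ⟨-1, 2 * D, by ring⟩
    have h3 : IsCoprime (8 * (D : ℤ) ^ 2 - 1) 3 := by
      rcases (by omega : D % 3 = 1 ∨ D % 3 = 2) with h | h
      · obtain ⟨j, hj⟩ : ∃ j : ℤ, (D : ℤ) = 3 * j + 1 := ⟨D / 3, by omega⟩
        exact ⟨1, -(24 * j ^ 2 + 16 * j + 2), by rw [hj]; ring⟩
      · obtain ⟨j, hj⟩ : ∃ j : ℤ, (D : ℤ) = 3 * j + 2 := ⟨D / 3, by omega⟩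
        exact ⟨1, -(24 * j ^ 2 + 32 * j + 10), by rw [hj]; ring⟩
    have := h4D.mul_right h3
    convert this using 1
    push_cast; ring
  obtain ⟨l, hlD, hl, hmod⟩ := Nat.forall_exists_prime_gt_and_zmodEq D
    (q := 12 * D) (by omega) hcop
  obtain ⟨k, hk⟩ := hmod.symm.dvd
  push_cast at hk
  have hN : (l + 1) % (4 * D) = 0 := by
    apply Nat.mod_eq_zero_of_dvd
    zify
    exact ⟨2 * D + 3 * k, by linear_combination hk⟩
  have hl4 : l % 4 = 3 := by
    have := (dvd_mul_right 4 D).trans (Nat.dvd_of_mod_eq_zero hN)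
    omega
  have hl3 : l % 3 = 1 := by
    have h2 : ((D : ℤ) ^ 2) % 3 = 1 := by
      rcases (by omega : (D : ℤ) % 3 = 1 ∨ (D : ℤ) % 3 = 2) with h | h <;>
        simp [pow_two, Int.mul_emod, h]
    have : (l : ℤ) = 8 * (D : ℤ) ^ 2 - 1 + 3 * (4 * D * k) := by linear_combination hk
    omega
  obtain ⟨β, hβ⟩ := exists_dvd_sq_sub_of_jacobiSym_eq_one hl
    (jacobiSym_eq_one_of_mod_four_mul hD0 hN)
  have hcop' : l.Coprime D := (hl.coprime_iff_not_dvd).mpr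
    fun h => absurd (Nat.le_of_dvd hD0 h) (by omega)
  obtain ⟨x, s, t, ht, h1⟩ := exists_sq_add_mul_sq_eq_mul_sq hD0 hl4 hcop' (α := 1)
    ⟨8 * D + 12 * k, by linear_combination hk⟩ hβ
  obtain ⟨y, z, r, hr, h2⟩ := exists_sq_add_three_mul_sq_eq_prime_mul_sq hl hl3
  refine exists_eq_of_mul_sq_eq_sq_add_sq_add_three_mul_sq (mul_ne_zero ht hr)
    (x := x * r) (y := y * s) (z := z * s) ?_
  linear_combination -r ^ 2 * h1 - s ^ 2 * h2

/-- Take a prime l with 3l ≡ -1 mod 4E. Then x² + 3ls² = Et² is solvable, and l ≡ 1 mod 4 gives l =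
y² + z². Multiplying by 3 yields 3Et² = (3ys)² + (3zs)² + 3x². -/
theorem exists_three_mul_eq_of_mod_three_eq_one {E : ℕ} (hE : E % 3 = 1) :
    ∃ w p q : ℤ, 3 * (E : ℤ) = w ^ 2 + (p ^ 2 + p * q + q ^ 2) := by
  have hE0 : 0 < E := by omega
  obtain ⟨e, he⟩ : ∃ e : ℕ, E = 3 * e + 1 := ⟨E / 3, by omega⟩
  have hcop : IsCoprime (4 * (e : ℤ) + 1) ((4 * E : ℕ) : ℤ) :=
    ⟨-3, 1, by rw [he]; push_cast; ring⟩
  obtain ⟨l, hlE, hl, hmod⟩ := Nat.forall_exists_prime_gt_and_zmodEq (E + 3)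
    (q := 4 * E) (by omega) hcop
  obtain ⟨k, hk⟩ := hmod.symm.dvd
  push_cast at hk
  have he' : (E : ℤ) = 3 * e + 1 := by exact_mod_cast he
  have hN : (3 * l + 1) % (4 * E) = 0 := by
    apply Nat.mod_eq_zero_of_dvd
    zify
    exact ⟨1 + 3 * k, by linear_combination 3 * hk - 4 * he'⟩
  have hl4 : l % 4 = 1 := by
    have := (dvd_mul_right 4 E).trans (Nat.dvd_of_mod_eq_zero hN)
    omega
  have hj : jacobiSym E l = 1 := by
    have h := jacobiSym_eq_one_of_mod_four_mul hE0 hN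
    have h3 : jacobiSym E 3 = 1 := by
      rw [jacobiSym.mod_left' (a₂ := 1), jacobiSym.one_left]
      omega
    rwa [jacobiSym.mul_right' _ (by norm_num) hl.ne_zero, h3, one_mul] at h
  obtain ⟨c, hc⟩ := exists_dvd_sq_sub_of_jacobiSym_eq_one hl hj
  have hl3 : Nat.Coprime 3 l := by
    rw [Nat.coprime_primes Nat.prime_three hl]
    omega
  have hl3' : IsCoprime (3 : ℤ) l := by exact_mod_cast Nat.isCoprime_iff_coprime.mpr hl3
  -- Chinese remainder: β ≡ c mod l and β ≡ 1 mod 3, the latter because E ≡ 1 mod 3.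
  obtain ⟨β, hβ⟩ : ∃ β : ℤ, ((3 * l : ℕ) : ℤ) ∣ β ^ 2 - E := by
    obtain ⟨u, v, huv⟩ := id hl3'
    refine ⟨c + (1 - c) * (v * l), ?_⟩
    push_cast
    refine hl3'.mul_dvd ?_ ?_
    · have : c + (1 - c) * (v * l) = 1 - 3 * ((1 - c) * u) := by
        linear_combination (1 - c) * huv
      rw [this]
      exact ⟨-2 * ((1 - c) * u) + 3 * ((1 - c) * u) ^ 2 - e, by rw [he']; ring⟩
    · obtain ⟨d, hd⟩ := hc
      exact ⟨d + 2 * c * (1 - c) * v + (1 - c) ^ 2 * v ^ 2 * l, by linear_combination hd⟩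
  have hcop' : (3 * l).Coprime E := by
    refine Nat.Coprime.mul_left ?_ ?_
    · rw [Nat.prime_three.coprime_iff_not_dvd]; omega
    · exact (hl.coprime_iff_not_dvd).mpr fun h => absurd (Nat.le_of_dvd hE0 h) (by omega)
  obtain ⟨x, s, t, ht, h1⟩ := exists_sq_add_mul_sq_eq_mul_sq hE0 (by omega) hcop' (α := 1)
    ⟨4 + 12 * k, by push_cast; linear_combination 3 * hk - 4 * he'⟩ hβ
  have : Fact l.Prime := ⟨hl⟩
  obtain ⟨y, z, h2⟩ := Nat.Prime.sq_add_sq (p := l) (by omega)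
  have h2' : (y : ℤ) ^ 2 + (z : ℤ) ^ 2 = l := by exact_mod_cast h2
  push_cast at h1
  refine exists_eq_of_mul_sq_eq_sq_add_sq_add_three_mul_sq ht
    (x := 3 * y * s) (y := 3 * z * s) (z := x) ?_
  linear_combination -3 * h1 - 9 * s ^ 2 * h2'

/-! ### From the ternary form to the Cauchy lemma -/

theorem Int.sq_emod_three (x : ℤ) : x % 3 = 0 ∧ x ^ 2 % 3 = 0 ∨ x % 3 ≠ 0 ∧ x ^ 2 % 3 = 1 := by
  rcases (by omega : x % 3 = 0 ∨ x % 3 = 1 ∨ x % 3 = 2) with h | h | h <;>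
    simp [pow_two, Int.mul_emod, h]

theorem Int.sq_emod_four' (x : ℤ) : x % 2 = 0 ∧ x ^ 2 % 4 = 0 ∨ x % 2 = 1 ∧ x ^ 2 % 4 = 1 := by
  rcases (by omega : x % 4 = 0 ∨ x % 4 = 1 ∨ x % 4 = 2 ∨ x % 4 = 3) with h | h | h | h <;>
    simp [pow_two, Int.mul_emod, h] <;> omega

theorem exists_sq_add_three_mul_sq_eq (p q : ℤ) :
    ∃ y z : ℤ, p ^ 2 + p * q + q ^ 2 = y ^ 2 + 3 * z ^ 2 := by
  obtain ⟨k, rfl⟩ | ⟨k, rfl⟩ | ⟨k, rfl⟩ :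
      (∃ k, q = 2 * k) ∨ (∃ k, p = 2 * k) ∨ ∃ k, p = q + 2 * k := by
    rcases (by omega : q = 2 * (q / 2) ∨ p = 2 * (p / 2) ∨ p = q + 2 * ((p - q) / 2)) with h | h | h
    · exact Or.inl ⟨_, h⟩
    · exact Or.inr (Or.inl ⟨_, h⟩)
    · exact Or.inr (Or.inr ⟨_, h⟩)
  · exact ⟨p + k, k, by ring⟩
  · exact ⟨q + k, k, by ring⟩
  · exact ⟨k, q + k, by ring⟩

/-- Write D = w² + y² + 3z². If z differed in parity from both w and y, then D would be 2 or 3 mod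
4. The variable congruent to z is absorbed through (2k + z)² + 3z² = 4(k² + kz + z²). -/
theorem exists_eq_sq_add_four_mul {D : ℤ} (hD : D % 4 = 0 ∨ D % 4 = 1)
    (h : ∃ w p q : ℤ, D = w ^ 2 + (p ^ 2 + p * q + q ^ 2)) :
    ∃ w p q : ℤ, D = w ^ 2 + 4 * (p ^ 2 + p * q + q ^ 2) := by
  obtain ⟨w, p, q, h⟩ := h
  obtain ⟨y, z, hyz⟩ := exists_sq_add_three_mul_sq_eq p q
  rw [hyz] at h
  have hpar : (∃ k, y = 2 * k + z) ∨ ∃ k, w = 2 * k + z := by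
    have := Int.sq_emod_four' w
    have := Int.sq_emod_four' y
    have := Int.sq_emod_four' z
    rcases (by omega : y = 2 * ((y - z) / 2) + z ∨ w = 2 * ((w - z) / 2) + z) with h | h
    · exact Or.inl ⟨_, h⟩
    · exact Or.inr ⟨_, h⟩
  rcases hpar with ⟨k, rfl⟩ | ⟨k, rfl⟩
  · exact ⟨w, k, z, by rw [h]; ring⟩
  · exact ⟨y, k, z, by rw [h]; ring⟩

theorem exists_int_sum_sq_eq_and_sum_eq {a b : ℤ} (hpar : (a - b) % 2 = 0) (hlt : b ^ 2 < 6 * a)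
    (h3 : b % 3 ≠ 0 ∨ a % 3 = 2) :
    ∃ x₁ x₂ x₃ x₄ : ℤ, x₁ ^ 2 + x₂ ^ 2 + x₃ ^ 2 + 3 * x₄ ^ 2 = a ∧
      x₁ + x₂ + x₃ + 3 * x₄ = b := by
  -- If 3 ∤ b, then 3 ∤ 6a - b². If b = 3c, then 6a - b² = 3(2a - 3c²), and the cofactor is 1 mod 3
  -- exactly when a ≡ 2 mod 3.
  have hrep : ∃ w p q : ℤ, 6 * a - b ^ 2 = w ^ 2 + (p ^ 2 + p * q + q ^ 2) := by
    rcases Int.sq_emod_three b with ⟨hb, hb2⟩ | ⟨hb, hb2⟩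
    · obtain ⟨c, rfl⟩ : ∃ c, b = 3 * c := ⟨b / 3, by omega⟩
      obtain ⟨E, hE⟩ := Int.eq_ofNat_of_zero_le (a := 2 * a - 3 * c ^ 2) (by linarith)
      obtain ⟨w, p, q, h⟩ := exists_three_mul_eq_of_mod_three_eq_one (E := E) (by omega)
      exact ⟨w, p, q, by rw [← h, ← hE]; ring⟩
    · obtain ⟨E, hE⟩ := Int.eq_ofNat_of_zero_le (a := 6 * a - b ^ 2) (by linarith)
      rw [hE]
      exact exists_eq_of_mod_three_ne_zero (by omega)
  obtain ⟨w, p, q, h⟩ := exists_eq_sq_add_four_mul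
    (by have := Int.sq_emod_four' b; omega) hrep
  -- Modulo 3, b² + w² + (p - q)² ≡ 0, so all three of b, w, p - q are divisible by 3 or none is.
  -- Changing the signs of w and of (p, q) then achieves the congruences needed to solve for v and
  -- x.
  have key : ∃ w p q v x : ℤ, 6 * a - b ^ 2 = w ^ 2 + 4 * (p ^ 2 + p * q + q ^ 2) ∧
      w = 6 * v - b ∧ b = 3 * x + p - q + 3 * v := by
    have h' : 6 * a - b ^ 2 = w ^ 2 + 4 * (p - q) ^ 2 + 12 * (p * q) := by rw [h]; ring
    have hpar' : (w + b) % 2 = 0 := by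
      have hw2 := Int.sq_emod_four' w
      have hb2 := Int.sq_emod_four' b
      omega
    have hmod : w % 3 = 0 ∧ b % 3 = 0 ∧ (p - q) % 3 = 0 ∨
        w % 3 ≠ 0 ∧ b % 3 ≠ 0 ∧ (p - q) % 3 ≠ 0 := by
      have hsum : (b ^ 2 + w ^ 2 + (p - q) ^ 2) % 3 = 0 := by omega
      rcases Int.sq_emod_three w with hw | hw <;> rcases Int.sq_emod_three b with hb | hb <;>
        rcases Int.sq_emod_three (p - q) with he | he <;> omega
    clear h3 hlt h' hrep
    have hww : (w + b) % 6 = 0 ∨ (-w + b) % 6 = 0 := by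
      rcases (by omega : w % 3 = 0 ∨ w % 3 = 1 ∨ w % 3 = 2) with hw | hw | hw <;>
        rcases (by omega : b % 3 = 0 ∨ b % 3 = 1 ∨ b % 3 = 2) with hb | hb | hb <;> omega
    have hee : (b - (p - q)) % 3 = 0 ∨ (b + (p - q)) % 3 = 0 := by
      rcases (by omega : b % 3 = 0 ∨ b % 3 = 1 ∨ b % 3 = 2) with hb | hb | hb <;> omega
    rcases hww with hww | hww <;> rcases hee with hee | hee
    · exact ⟨w, p, q, (w + b) / 6, (b - (p - q)) / 3 - (w + b) / 6, h, by omega, by omega⟩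
    · exact ⟨w, -p, -q, (w + b) / 6, (b + (p - q)) / 3 - (w + b) / 6, by rw [h]; ring, by omega,
        by omega⟩
    · exact ⟨-w, p, q, (-w + b) / 6, (b - (p - q)) / 3 - (-w + b) / 6, by rw [h]; ring, by omega,
        by omega⟩
    · exact ⟨-w, -p, -q, (-w + b) / 6, (b + (p - q)) / 3 - (-w + b) / 6, by rw [h]; ring,
        by omega, by omega⟩
  obtain ⟨w, p, q, v, x, h, rfl, rfl⟩ := key
  refine ⟨x + p, x, x - q, v, ?_, by ring⟩
  refine mul_left_cancel₀ (by norm_num : (6 : ℤ) ≠ 0) ?_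
  linear_combination -h

/-- An analogue of Cauchy's lemma for the weights `1, 1, 1, 3`. -/
theorem exists_nat_sum_sq_eq_and_sum_eq {a b : ℤ} (hpar : (a - b) % 2 = 0) (hb : 0 ≤ b)
    (hlt : b ^ 2 < 6 * a) (hle : 5 * a ≤ b ^ 2 + 2 * b) (h3 : b % 3 ≠ 0 ∨ a % 3 = 2) :
    ∃ x₁ x₂ x₃ x₄ : ℕ, (x₁ : ℤ) ^ 2 + (x₂ : ℤ) ^ 2 + (x₃ : ℤ) ^ 2 + 3 * (x₄ : ℤ) ^ 2 = a ∧
      (x₁ : ℤ) + x₂ + x₃ + 3 * x₄ = b := by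
  obtain ⟨x₁, x₂, x₃, x₄, ha, hs⟩ := exists_int_sum_sq_eq_and_sum_eq hpar hlt h3
  -- The remaining weights sum to 5, so x ≤ -1 would give b² + 2b + 6 ≤ (b - x)² + 5x² ≤ 5a. For x₄
  -- the remaining weight is 3, and the contradiction is stronger.
  have hsmall : ∀ x y z v : ℤ, x ^ 2 + y ^ 2 + z ^ 2 + 3 * v ^ 2 = a → x + y + z + 3 * v = b →
      0 ≤ x := by
    intro x y z v h1 h2
    by_contra hx
    push Not at hx
    have hc : (y + z + 3 * v) ^ 2 ≤ 5 * (y ^ 2 + z ^ 2 + 3 * v ^ 2) := by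
      nlinarith [sq_nonneg (y - z), sq_nonneg (y - v), sq_nonneg (z - v)]
    have e1 : y + z + 3 * v = b - x := by linarith
    rw [e1] at hc
    nlinarith [mul_nonneg hb (by omega : 0 ≤ -x - 1)]
  have h4 : 0 ≤ x₄ := by
    by_contra hx
    push Not at hx
    have hc : (x₁ + x₂ + x₃) ^ 2 ≤ 3 * (x₁ ^ 2 + x₂ ^ 2 + x₃ ^ 2) := by
      nlinarith [sq_nonneg (x₁ - x₂), sq_nonneg (x₁ - x₃), sq_nonneg (x₂ - x₃)]
    have e1 : x₁ + x₂ + x₃ = b - 3 * x₄ := by linarith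
    rw [e1] at hc
    nlinarith [mul_nonneg hb (by omega : 0 ≤ -x₄ - 1)]
  have h1 := hsmall x₁ x₂ x₃ x₄ ha hs
  have h2 := hsmall x₂ x₁ x₃ x₄ (by linarith) (by linarith)
  have h3 := hsmall x₃ x₂ x₁ x₄ (by linarith) (by linarith)
  lift x₁ to ℕ using h1
  lift x₂ to ℕ using h2
  lift x₃ to ℕ using h3
  lift x₄ to ℕ using h4
  exact ⟨x₁, x₂, x₃, x₄, ha, hs⟩

/-! ### Choosing a and b for large n -/

theorem exists_and_not_succ {P : ℕ → Prop} (h0 : P 0) {N : ℕ} (hN : ¬ P N) :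
    ∃ j < N, P j ∧ ¬ P (j + 1) := by
  by_contra! h
  have : ∀ j ≤ N, P j := by
    intro j
    induction j with
    | zero => exact fun _ => h0
    | succ j ih => exact fun hj => h j (by omega) (ih (by omega))
  exact hN (this N le_rfl)

/-- With n = r + mq, the pairs b = r + mj, a = b + 2(q - j) all satisfy the linear relation. Taking
j just before b² < 6a fails puts a near b²/6, below the bound (b² + 2b)/5. Stepping back by at most
two indices fixes the condition modulo 3 while keeping both inequalities. -/
theorem exists_cauchy_parameters {m : ℤ} (hm3 : 3 ≤ m) (hm8 : m ≤ 8) {n : ℤ} (hn : 60000 ≤ n) :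
    ∃ a b : ℤ, (a - b) % 2 = 0 ∧ 0 ≤ b ∧ b ^ 2 < 6 * a ∧ 5 * a ≤ b ^ 2 + 2 * b ∧
      (b % 3 ≠ 0 ∨ a % 3 = 2) ∧ 2 * n = m * (a - b) + 2 * b := by
  obtain ⟨q, hq⟩ : ∃ q : ℕ, n / m = q :=
    Int.eq_ofNat_of_zero_le (Int.ediv_nonneg (by omega) (by omega))
  obtain ⟨r, hr⟩ : ∃ r, n % m = r := ⟨_, rfl⟩
  have hr0 : 0 ≤ r := hr ▸ Int.emod_nonneg _ (by omega)
  have hrm : r < m := hr ▸ Int.emod_lt_of_pos _ (by omega)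
  have hnq : n = r + m * q := by rw [← hr, ← hq]; exact (Int.emod_add_mul_ediv n m).symm
  obtain ⟨j, hjq, hj, hj'⟩ := exists_and_not_succ (N := q)
    (P := fun j : ℕ => (r + m * j) ^ 2 < 6 * (r + m * j + 2 * ((q : ℤ) - j)))
    (by
      have : 8 ≤ (q : ℤ) := by nlinarith
      push_cast
      nlinarith)
    (by
      rw [← hnq]
      nlinarith)
  push_cast at hj hj'
  obtain ⟨b, hb⟩ : ∃ b, b = r + m * j := ⟨_, rfl⟩
  obtain ⟨a, ha⟩ : ∃ a, a = b + 2 * ((q : ℤ) - j) := ⟨_, rfl⟩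
  have hb0 : 0 ≤ b := by rw [hb]; positivity
  have e1 : b ^ 2 < 6 * a := by rw [ha, hb]; exact hj
  have e2 : 6 * (a + m - 2) ≤ (b + m) ^ 2 := by
    rw [ha, hb]
    push Not at hj'
    linear_combination hj'
  have e3 : 2 * n = m * (a - b) + 2 * b := by rw [ha, hnq, hb]; ring
  -- Otherwise 6(a + m - 2) ≤ 287² and 2n ≤ ma would force n < 60000. The bound leaves room for K =
  -- 2 and m = 8, the tightest case.
  have hb280 : 280 ≤ b := by
    by_contra hlt
    have h1 : (b + m) ^ 2 ≤ (279 + m) ^ 2 := by gcongr; omega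
    interval_cases m <;> omega
  have main : ∀ K : ℤ, K = 0 ∨ K = 1 ∨ K = 2 →
      ((b - m * K) % 3 ≠ 0 ∨ (a - (m - 2) * K) % 3 = 2) → ∃ a b : ℤ, (a - b) % 2 = 0 ∧ 0 ≤ b ∧
      b ^ 2 < 6 * a ∧ 5 * a ≤ b ^ 2 + 2 * b ∧
      (b % 3 ≠ 0 ∨ a % 3 = 2) ∧ 2 * n = m * (a - b) + 2 * b := by
    intro K hK h3
    refine ⟨a - (m - 2) * K, b - m * K, ?_, ?_, ?_, ?_, h3, by linear_combination e3⟩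
    · have : a - (m - 2) * K - (b - m * K) = 2 * (q - j + K) := by rw [ha]; ring
      omega
    · interval_cases m <;> omega
    · clear * - e1 hb280 hK hm3 hm8
      rcases hK with rfl | rfl | rfl <;> interval_cases m <;> linarith
    · have e4 : 0 ≤ b * (b - 280) := mul_nonneg hb0 (by omega)
      clear * - e2 e4 hb280 hK hm3 hm8
      rcases hK with rfl | rfl | rfl <;> interval_cases m <;> linarith
  -- If 3 ∤ m, the values b - mK run through all residues mod 3. If 3 ∣ m, then m - 2 ≡ 1 and the
  -- values a - (m - 2)K do.
  have hsel : ∃ K : ℤ, (K = 0 ∨ K = 1 ∨ K = 2) ∧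
      ((b - m * K) % 3 ≠ 0 ∨ (a - (m - 2) * K) % 3 = 2) := by
    by_contra! hcon
    have h0 := hcon 0 (by simp)
    have h1 := hcon 1 (by simp)
    have h2 := hcon 2 (by simp)
    clear * - h0 h1 h2 hm3 hm8
    rcases (by omega : a % 3 = 0 ∨ a % 3 = 1 ∨ a % 3 = 2) with h | h | h <;>
      interval_cases m <;> omega
  obtain ⟨K, hK, h3⟩ := hsel
  exact main K hK h3

theorem exists_nat_eq_of_large {m : ℕ} (hm3 : 3 ≤ m) (hm8 : m ≤ 8) {n : ℤ} (hn : 60000 ≤ n) :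
    ∃ x₁ x₂ x₃ x₄ : ℕ, n = polygonalNumber (m + 2) x₁ + polygonalNumber (m + 2) x₂
      + polygonalNumber (m + 2) x₃ + 3 * polygonalNumber (m + 2) x₄ := by
  obtain ⟨a, b, hpar, hb, hlt, hle, h3, hab⟩ :=
    exists_cauchy_parameters (m := m) (by omega) (by omega) hn
  obtain ⟨x₁, x₂, x₃, x₄, ha, hs⟩ := exists_nat_sum_sq_eq_and_sum_eq hpar hb hlt hle h3
  refine ⟨x₁, x₂, x₃, x₄, ?_⟩
  have h1 := two_mul_polygonalNumber (m + 2) x₁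
  have h2 := two_mul_polygonalNumber (m + 2) x₂
  have h3 := two_mul_polygonalNumber (m + 2) x₃
  have h4 := two_mul_polygonalNumber (m + 2) x₄
  push_cast at h1 h2 h3 h4
  refine mul_left_cancel₀ (two_ne_zero (α := ℤ)) ?_
  linear_combination hab - h1 - h2 - h3 - 3 * h4 - m * ha + (m - 2) * hs

/-! ### Sumsets as bit masks -/

/-- If the bits of `T` are the indicator function of a set, those of `sumsetMask l T` are the
indicator function of its sumset with `l`. The case distinction makes the kernel evaluate `T`
before it is used repeatedly. -/
def sumsetMask (l : List ℕ) (T : ℕ) : ℕ :=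
  match T with
  | 0 => 0
  | k + 1 => l.foldr (fun s acc => Nat.lor acc (Nat.shiftLeft (k + 1) s)) 0

theorem testBit_sumsetMask (l : List ℕ) (T n : ℕ) :
    (sumsetMask l T).testBit n = true ↔ ∃ s ∈ l, ∃ t, T.testBit t = true ∧ n = s + t := by
  rcases T with _ | k
  · simp [sumsetMask]
  induction l with
  | nil => simp [sumsetMask]
  | cons s l ih =>
    have h : sumsetMask (s :: l) (k + 1) = sumsetMask l (k + 1) ||| (k + 1) <<< s := rfl
    rw [h, Nat.testBit_or, Bool.or_eq_true, ih, Nat.testBit_shiftLeft]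
    simp only [List.mem_cons, exists_eq_or_imp, Bool.and_eq_true, decide_eq_true_eq]
    rw [or_comm]
    refine or_congr ⟨fun ⟨h1, h2⟩ => ⟨_, h2, by omega⟩, ?_⟩ Iff.rfl
    rintro ⟨t, ht, rfl⟩
    exact ⟨by omega, by simpa using ht⟩

theorem testBit_sumsetMask_one (l : List ℕ) (n : ℕ) :
    (sumsetMask l 1).testBit n = true ↔ n ∈ l := by
  simp [testBit_sumsetMask, Nat.testBit_one_eq_true_iff_self_eq_zero]

/-- Bit mask of the numbers `r + s + t + 3 * u` with `r ∈ l'` and `s, t, u ∈ l`. -/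
def quaternaryMask (l' l : List ℕ) : ℕ :=
  sumsetMask l' (sumsetMask l (sumsetMask l (sumsetMask (l.map (3 * ·)) 1)))

theorem testBit_quaternaryMask (l' l : List ℕ) (n : ℕ) :
    (quaternaryMask l' l).testBit n = true ↔
      ∃ r ∈ l', ∃ s ∈ l, ∃ t ∈ l, ∃ u ∈ l, n = r + s + t + 3 * u := by
  simp only [quaternaryMask, testBit_sumsetMask, Nat.testBit_one_eq_true_iff_self_eq_zero,
    List.mem_map]
  constructor
  · rintro ⟨r, hr, _, ⟨s, hs, _, ⟨t, ht, _, ⟨_, ⟨u, hu, rfl⟩, _, rfl, rfl⟩, rfl⟩, rfl⟩, rfl⟩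
    exact ⟨r, hr, s, hs, t, ht, u, hu, by ring⟩
  · rintro ⟨r, hr, s, hs, t, ht, u, hu, rfl⟩
    exact ⟨r, hr, _, ⟨s, hs, _, ⟨t, ht, _, ⟨_, ⟨u, hu, rfl⟩, _, rfl, rfl⟩, rfl⟩, rfl⟩, by ring⟩

/-- All bits of `T` below `N` are set, except possibly those in `exc`. -/
def CoversBelow (N : ℕ) (exc : List ℕ) (T : ℕ) : Prop :=
  Nat.land (Nat.lor T (sumsetMask exc 1)) (2 ^ N - 1) = 2 ^ N - 1

instance (N : ℕ) (exc : List ℕ) (T : ℕ) : Decidable (CoversBelow N exc T) :=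
  inferInstanceAs (Decidable (_ = _))

theorem CoversBelow.testBit {N : ℕ} {exc : List ℕ} {T n : ℕ} (h : CoversBelow N exc T)
    (hn : n < N) (hexc : n ∉ exc) : T.testBit n = true := by
  have h' : ((T ||| sumsetMask exc 1) &&& (2 ^ N - 1)).testBit n = (2 ^ N - 1).testBit n :=
    congrArg (fun x : ℕ => x.testBit n) h
  rw [Nat.testBit_and, Nat.testBit_or, Nat.testBit_two_pow_sub_one, decide_eq_true hn,
    Bool.and_true, Bool.or_eq_true, testBit_sumsetMask_one] at h'
  exact h'.resolve_right hexc

/-- The polygonal numbers of order `m + 2` at the arguments `0, 1, …, 299`. -/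
def polygonalList (m : ℕ) : List ℕ :=
  (List.range 300).map fun x => m * (x * (x - 1) / 2) + x

/-- The generalized polygonal numbers of order `m + 2` at the arguments `-299, …, 299`. -/
def generalizedPolygonalList (m : ℕ) : List ℕ :=
  polygonalList m ++ (List.range 300).map fun x => m * (x * (x + 1) / 2) - x

/-- For x = -y ≤ 0 the value is m·y(y - 1)/2 + (m - 1)y, whence the need for m ≥ 2. The bound shows
that truncating arguments at 300 loses no representation of any n < 300, so a cleared bit there
proves that n is not represented. -/
theorem natAbs_le_polygonalNumber {m : ℕ} (hm : 2 ≤ m) (x : ℤ) :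
    (x.natAbs : ℤ) ≤ polygonalNumber (m + 2) x := by
  have h := two_mul_polygonalNumber (m + 2) x
  push_cast at h
  have hm' : (2 : ℤ) ≤ m := by exact_mod_cast hm
  rcases le_total 0 x with hx | hx
  · rw [Int.natAbs_of_nonneg hx]
    rcases hx.eq_or_lt with rfl | hx
    · linarith
    · nlinarith [mul_nonneg (by linarith : (0 : ℤ) ≤ m)
        (mul_nonneg hx.le (by omega : (0 : ℤ) ≤ x - 1))]
  · rw [Int.ofNat_natAbs_of_nonpos hx]
    rcases hx.eq_or_lt with rfl | hx
    · linarith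
    · nlinarith [mul_nonneg (by linarith : (0 : ℤ) ≤ m)
        (mul_nonneg (by omega : (0 : ℤ) ≤ -x) (by omega : (0 : ℤ) ≤ -x - 1)),
        mul_nonneg (by linarith : (0 : ℤ) ≤ (m : ℤ) - 2) (by omega : (0 : ℤ) ≤ -x)]

theorem mem_polygonalList {m s : ℕ} :
    s ∈ polygonalList m ↔ ∃ x : ℕ, x < 300 ∧ polygonalNumber (m + 2) x = s := by
  simp only [polygonalList, List.mem_map, List.mem_range]
  refine exists_congr fun x => and_congr_right fun _ => ?_
  rw [polygonalNumber_natCast, Nat.choose_two_right]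
  norm_cast

theorem polygonalNumber_neg_natCast {m : ℕ} (hm : 2 ≤ m) (x : ℕ) :
    polygonalNumber (m + 2) (-x) = (m * (x * (x + 1) / 2) - x : ℕ) := by
  have hdvd : x * (x + 1) / 2 * 2 = x * (x + 1) :=
    Nat.div_mul_cancel (Nat.even_mul_succ_self x).two_dvd
  have hle : x ≤ m * (x * (x + 1) / 2) :=
    calc x ≤ x * (x + 1) := Nat.le_mul_of_pos_right _ (by omega)
      _ = 2 * (x * (x + 1) / 2) := by rw [mul_comm 2, hdvd]
      _ ≤ m * (x * (x + 1) / 2) := Nat.mul_le_mul_right _ hm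
  have h := two_mul_polygonalNumber (m + 2) (-x)
  rw [Nat.cast_sub hle]
  push_cast at h ⊢
  refine mul_left_cancel₀ (two_ne_zero (α := ℤ)) ?_
  have hdvd' : ((x * (x + 1) / 2 : ℕ) : ℤ) * 2 = x * (x + 1) := by exact_mod_cast hdvd
  push_cast at hdvd'
  linear_combination h - m * hdvd'

theorem mem_generalizedPolygonalList {m s : ℕ} (hm : 2 ≤ m) :
    s ∈ generalizedPolygonalList m ↔
      ∃ x : ℤ, x.natAbs < 300 ∧ polygonalNumber (m + 2) x = s := by
  simp only [generalizedPolygonalList, List.mem_append, mem_polygonalList, List.mem_map,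
    List.mem_range]
  constructor
  · rintro (⟨x, hx, h⟩ | ⟨x, hx, h⟩)
    · exact ⟨x, by simpa using hx, h⟩
    · exact ⟨-x, by simpa using hx, by rw [polygonalNumber_neg_natCast hm, h]⟩
  · rintro ⟨x, hx, h⟩
    rcases Int.natAbs_eq x with hx' | hx'
    · exact Or.inl ⟨x.natAbs, hx, by rw [← hx', h]⟩
    · refine Or.inr ⟨x.natAbs, hx, ?_⟩
      rw [hx', polygonalNumber_neg_natCast hm] at h
      exact_mod_cast h

theorem exists_nat_of_testBit {m n : ℕ}
    (h : (quaternaryMask (polygonalList m) (polygonalList m)).testBit n = true) :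
    ∃ x₁ x₂ x₃ x₄ : ℕ, (n : ℤ) = polygonalNumber (m + 2) x₁ + polygonalNumber (m + 2) x₂
      + polygonalNumber (m + 2) x₃ + 3 * polygonalNumber (m + 2) x₄ := by
  obtain ⟨r, hr, s, hs, t, ht, u, hu, rfl⟩ := (testBit_quaternaryMask _ _ _).mp h
  obtain ⟨x₁, -, h₁⟩ := mem_polygonalList.mp hr
  obtain ⟨x₂, -, h₂⟩ := mem_polygonalList.mp hs
  obtain ⟨x₃, -, h₃⟩ := mem_polygonalList.mp ht
  obtain ⟨x₄, -, h₄⟩ := mem_polygonalList.mp hu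
  exact ⟨x₁, x₂, x₃, x₄, by rw [h₁, h₂, h₃, h₄]; push_cast; ring⟩

theorem exists_int_nat_of_testBit {m n : ℕ} (hm : 2 ≤ m)
    (h : (quaternaryMask (generalizedPolygonalList m) (polygonalList m)).testBit n = true) :
    ∃ x₁ : ℤ, ∃ x₂ x₃ x₄ : ℕ, (n : ℤ) = polygonalNumber (m + 2) x₁ + polygonalNumber (m + 2) x₂
      + polygonalNumber (m + 2) x₃ + 3 * polygonalNumber (m + 2) x₄ := by
  obtain ⟨r, hr, s, hs, t, ht, u, hu, rfl⟩ := (testBit_quaternaryMask _ _ _).mp h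
  obtain ⟨x₁, -, h₁⟩ := (mem_generalizedPolygonalList hm).mp hr
  obtain ⟨x₂, -, h₂⟩ := mem_polygonalList.mp hs
  obtain ⟨x₃, -, h₃⟩ := mem_polygonalList.mp ht
  obtain ⟨x₄, -, h₄⟩ := mem_polygonalList.mp hu
  exact ⟨x₁, x₂, x₃, x₄, by rw [h₁, h₂, h₃, h₄]; push_cast; ring⟩

theorem exists_int_of_testBit {m n : ℕ} (hm : 2 ≤ m)
    (h : (quaternaryMask (generalizedPolygonalList m)
      (generalizedPolygonalList m)).testBit n = true) :
    ∃ x₁ x₂ x₃ x₄ : ℤ, (n : ℤ) = polygonalNumber (m + 2) x₁ + polygonalNumber (m + 2) x₂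
      + polygonalNumber (m + 2) x₃ + 3 * polygonalNumber (m + 2) x₄ := by
  obtain ⟨r, hr, s, hs, t, ht, u, hu, rfl⟩ := (testBit_quaternaryMask _ _ _).mp h
  obtain ⟨x₁, -, h₁⟩ := (mem_generalizedPolygonalList hm).mp hr
  obtain ⟨x₂, -, h₂⟩ := (mem_generalizedPolygonalList hm).mp hs
  obtain ⟨x₃, -, h₃⟩ := (mem_generalizedPolygonalList hm).mp ht
  obtain ⟨x₄, -, h₄⟩ := (mem_generalizedPolygonalList hm).mp hu
  exact ⟨x₁, x₂, x₃, x₄, by rw [h₁, h₂, h₃, h₄]; push_cast; ring⟩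

/-- A representation of a small number only involves small arguments. -/
theorem exists_natCast_and_natAbs_lt {m n : ℕ} (hm : 2 ≤ m) (hn : n < 300) {x₁ x₂ x₃ x₄ : ℤ}
    (h : (n : ℤ) = polygonalNumber (m + 2) x₁ + polygonalNumber (m + 2) x₂
      + polygonalNumber (m + 2) x₃ + 3 * polygonalNumber (m + 2) x₄) :
    (x₁.natAbs < 300 ∧ x₂.natAbs < 300 ∧ x₃.natAbs < 300 ∧ x₄.natAbs < 300) ∧
      ∃ r s t u : ℕ, polygonalNumber (m + 2) x₁ = r ∧ polygonalNumber (m + 2) x₂ = s ∧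
        polygonalNumber (m + 2) x₃ = t ∧ polygonalNumber (m + 2) x₄ = u ∧
        n = r + s + t + 3 * u := by
  have h₁ := natAbs_le_polygonalNumber hm x₁
  have h₂ := natAbs_le_polygonalNumber hm x₂
  have h₃ := natAbs_le_polygonalNumber hm x₃
  have h₄ := natAbs_le_polygonalNumber hm x₄
  refine ⟨by omega, (polygonalNumber (m + 2) x₁).toNat, (polygonalNumber (m + 2) x₂).toNat,
    (polygonalNumber (m + 2) x₃).toNat, (polygonalNumber (m + 2) x₄).toNat, ?_⟩
  omega

theorem testBit_of_eq_nat {m n : ℕ} (hm : 2 ≤ m) (hn : n < 300) {x₁ x₂ x₃ x₄ : ℕ}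
    (h : (n : ℤ) = polygonalNumber (m + 2) x₁ + polygonalNumber (m + 2) x₂
      + polygonalNumber (m + 2) x₃ + 3 * polygonalNumber (m + 2) x₄) :
    (quaternaryMask (polygonalList m) (polygonalList m)).testBit n = true := by
  obtain ⟨⟨h₁, h₂, h₃, h₄⟩, r, s, t, u, hr, hs, ht, hu, hsum⟩ :=
    exists_natCast_and_natAbs_lt hm hn h
  exact (testBit_quaternaryMask _ _ _).mpr ⟨r, mem_polygonalList.mpr ⟨x₁, h₁, hr⟩,
    s, mem_polygonalList.mpr ⟨x₂, h₂, hs⟩, t, mem_polygonalList.mpr ⟨x₃, h₃, ht⟩,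
    u, mem_polygonalList.mpr ⟨x₄, h₄, hu⟩, hsum⟩

theorem testBit_of_eq_int {m n : ℕ} (hm : 2 ≤ m) (hn : n < 300) {x₁ x₂ x₃ x₄ : ℤ}
    (h : (n : ℤ) = polygonalNumber (m + 2) x₁ + polygonalNumber (m + 2) x₂
      + polygonalNumber (m + 2) x₃ + 3 * polygonalNumber (m + 2) x₄) :
    (quaternaryMask (generalizedPolygonalList m)
      (generalizedPolygonalList m)).testBit n = true := by
  obtain ⟨⟨h₁, h₂, h₃, h₄⟩, r, s, t, u, hr, hs, ht, hu, hsum⟩ :=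
    exists_natCast_and_natAbs_lt hm hn h
  have hmem := fun s => mem_generalizedPolygonalList (s := s) hm
  exact (testBit_quaternaryMask _ _ _).mpr ⟨r, (hmem r).mpr ⟨x₁, h₁, hr⟩,
    s, (hmem s).mpr ⟨x₂, h₂, hs⟩, t, (hmem t).mpr ⟨x₃, h₃, ht⟩,
    u, (hmem u).mpr ⟨x₄, h₄, hu⟩, hsum⟩

theorem nonneg_of_eq {m : ℕ} (hm : 2 ≤ m) {n x₁ x₂ x₃ x₄ : ℤ}
    (h : n = polygonalNumber (m + 2) x₁ + polygonalNumber (m + 2) x₂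
      + polygonalNumber (m + 2) x₃ + 3 * polygonalNumber (m + 2) x₄) : 0 ≤ n := by
  have h₁ := natAbs_le_polygonalNumber hm x₁
  have h₂ := natAbs_le_polygonalNumber hm x₂
  have h₃ := natAbs_le_polygonalNumber hm x₃
  have h₄ := natAbs_le_polygonalNumber hm x₄
  omega

/-! ### Combining the large and the computed range -/

theorem exists_nat_of_coversBelow {m : ℕ} {exc : List ℕ} (hm3 : 3 ≤ m) (hm8 : m ≤ 8)
    (hcov : CoversBelow 60000 exc (quaternaryMask (polygonalList m) (polygonalList m)))
    {n : ℕ} (hn : n ∉ exc) :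
    ∃ x₁ x₂ x₃ x₄ : ℕ, (n : ℤ) = polygonalNumber (m + 2) x₁ + polygonalNumber (m + 2) x₂
      + polygonalNumber (m + 2) x₃ + 3 * polygonalNumber (m + 2) x₄ := by
  rcases lt_or_ge n 60000 with hlt | hge
  · exact exists_nat_of_testBit (hcov.testBit hlt hn)
  · exact exists_nat_eq_of_large hm3 hm8 (by exact_mod_cast hge)

theorem setOf_nat_eq {m : ℕ} (exc : List ℕ) (hm3 : 3 ≤ m) (hm8 : m ≤ 8)
    (hcov : CoversBelow 60000 exc (quaternaryMask (polygonalList m) (polygonalList m)))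
    (hexc : ∀ e ∈ exc, e < 300 ∧
      (quaternaryMask (polygonalList m) (polygonalList m)).testBit e = false) :
    {n : ℤ | ∃ x₁ x₂ x₃ x₄ : ℕ, n = polygonalNumber (m + 2) x₁ + polygonalNumber (m + 2) x₂
      + polygonalNumber (m + 2) x₃ + 3 * polygonalNumber (m + 2) x₄} =
      Set.range (Nat.cast : ℕ → ℤ) \ {z | ∃ e ∈ exc, z = (e : ℤ)} := by
  ext n
  constructor
  · rintro ⟨x₁, x₂, x₃, x₄, h⟩
    obtain ⟨k, rfl⟩ := Int.eq_ofNat_of_zero_le (nonneg_of_eq (by omega) h)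
    refine ⟨⟨k, rfl⟩, ?_⟩
    rintro ⟨e, he, hke⟩
    obtain rfl : k = e := by exact_mod_cast hke
    have := testBit_of_eq_nat (by omega) (hexc k he).1 h
    rw [(hexc k he).2] at this
    exact Bool.false_ne_true this
  · rintro ⟨⟨k, rfl⟩, hk⟩
    exact exists_nat_of_coversBelow hm3 hm8 hcov fun he => hk ⟨k, he, rfl⟩

theorem exists_nat_of_gt {m M : ℕ} (hm3 : 3 ≤ m) (hm8 : m ≤ 8)
    (hcov : CoversBelow 60000 (List.range (M + 1))
      (quaternaryMask (polygonalList m) (polygonalList m))) {n : ℤ} (hn : (M : ℤ) < n) :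
    ∃ x₁ x₂ x₃ x₄ : ℕ, n = polygonalNumber (m + 2) x₁ + polygonalNumber (m + 2) x₂
      + polygonalNumber (m + 2) x₃ + 3 * polygonalNumber (m + 2) x₄ := by
  obtain ⟨k, rfl⟩ := Int.eq_ofNat_of_zero_le (by omega : 0 ≤ n)
  exact exists_nat_of_coversBelow hm3 hm8 hcov (by rw [List.mem_range]; omega)

/-- Beyond M natural arguments already suffice, so generalized polygonal numbers need computing only
up to M. -/
theorem setOf_int_eq {m M : ℕ} (exc : List ℕ) (hm3 : 3 ≤ m)
    (hlarge : ∀ n : ℤ, (M : ℤ) < n → ∃ x₁ x₂ x₃ x₄ : ℕ, n = polygonalNumber (m + 2) x₁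
      + polygonalNumber (m + 2) x₂ + polygonalNumber (m + 2) x₃ + 3 * polygonalNumber (m + 2) x₄)
    (hcov : CoversBelow (M + 1) exc
      (quaternaryMask (generalizedPolygonalList m) (generalizedPolygonalList m)))
    (hexc : ∀ e ∈ exc, e < 300 ∧
      (quaternaryMask (generalizedPolygonalList m)
        (generalizedPolygonalList m)).testBit e = false) :
    {n : ℤ | ∃ x₁ x₂ x₃ x₄ : ℤ, n = polygonalNumber (m + 2) x₁ + polygonalNumber (m + 2) x₂
      + polygonalNumber (m + 2) x₃ + 3 * polygonalNumber (m + 2) x₄} =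
      Set.range (Nat.cast : ℕ → ℤ) \ {z | ∃ e ∈ exc, z = (e : ℤ)} := by
  ext n
  constructor
  · rintro ⟨x₁, x₂, x₃, x₄, h⟩
    obtain ⟨k, rfl⟩ := Int.eq_ofNat_of_zero_le (nonneg_of_eq (by omega) h)
    refine ⟨⟨k, rfl⟩, ?_⟩
    rintro ⟨e, he, hke⟩
    obtain rfl : k = e := by exact_mod_cast hke
    have := testBit_of_eq_int (by omega) (hexc k he).1 h
    rw [(hexc k he).2] at this
    exact Bool.false_ne_true this
  · rintro ⟨⟨k, rfl⟩, hk⟩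
    rcases lt_or_ge k (M + 1) with hlt | hge
    · exact exists_int_of_testBit (by omega) (hcov.testBit hlt fun he => hk ⟨k, he, rfl⟩)
    · obtain ⟨x₁, x₂, x₃, x₄, h⟩ := hlarge k (by omega)
      exact ⟨x₁, x₂, x₃, x₄, h⟩

theorem corollary1p3 :
    ({n : ℤ | ∃ x₁ x₂ x₃ x₄ : ℕ, n = polygonalNumber 5 x₁ + polygonalNumber 5 x₂
          + polygonalNumber 5 x₃ + 3 * polygonalNumber 5 x₄}
        = Set.range (Nat.cast : ℕ → ℤ) \ {19}) ∧
    ({n : ℤ | ∃ x₁ x₂ x₃ x₄ : ℕ, n = polygonalNumber 6 x₁ + polygonalNumber 6 x₂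
          + polygonalNumber 6 x₃ + 3 * polygonalNumber 6 x₄}
        = Set.range (Nat.cast : ℕ → ℤ) \ {14, 23, 41, 42, 83}) ∧
    ({n : ℤ | ∃ x₁ x₂ x₃ x₄ : ℕ, n = polygonalNumber 7 x₁ + polygonalNumber 7 x₂
          + polygonalNumber 7 x₃ + 3 * polygonalNumber 7 x₄}
        = Set.range (Nat.cast : ℕ → ℤ) \
          {13, 16, 27, 31, 33, 49, 50, 67, 87, 178, 181, 259}) ∧
    (∀ n : ℤ, 435 < n → ∃ x₁ x₂ x₃ x₄ : ℕ, n = polygonalNumber 8 x₁ + polygonalNumber 8 x₂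
          + polygonalNumber 8 x₃ + 3 * polygonalNumber 8 x₄) ∧
    (∀ n : ℤ, 695 < n → ∃ x₁ x₂ x₃ x₄ : ℕ, n = polygonalNumber 9 x₁ + polygonalNumber 9 x₂
          + polygonalNumber 9 x₃ + 3 * polygonalNumber 9 x₄) ∧
    (∀ n : ℤ, 916 < n → ∃ x₁ x₂ x₃ x₄ : ℕ, n = polygonalNumber 10 x₁ + polygonalNumber 10 x₂
          + polygonalNumber 10 x₃ + 3 * polygonalNumber 10 x₄) ∧
    ({n : ℤ | ∃ w : ℤ, ∃ x y z : ℕ, n = polygonalNumber 7 w + polygonalNumber 7 x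
          + polygonalNumber 7 y + 3 * polygonalNumber 7 z}
        = Set.range (Nat.cast : ℕ → ℤ)) ∧
    ({n : ℤ | ∃ x₁ x₂ x₃ x₄ : ℤ, n = polygonalNumber 9 x₁ + polygonalNumber 9 x₂
          + polygonalNumber 9 x₃ + 3 * polygonalNumber 9 x₄}
        = Set.range (Nat.cast : ℕ → ℤ) \ {17}) ∧
    ({n : ℤ | ∃ x₁ x₂ x₃ x₄ : ℤ, n = polygonalNumber 10 x₁ + polygonalNumber 10 x₂
          + polygonalNumber 10 x₃ + 3 * polygonalNumber 10 x₄}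
        = Set.range (Nat.cast : ℕ → ℤ) \ {16, 19}) := by
  have h8 : ∀ n : ℤ, 435 < n → ∃ x₁ x₂ x₃ x₄ : ℕ, n = polygonalNumber 8 x₁ + polygonalNumber 8 x₂
      + polygonalNumber 8 x₃ + 3 * polygonalNumber 8 x₄ := fun n hn =>
    exists_nat_of_gt (m := 6) (M := 435) (by norm_num) (by norm_num) (by decide +kernel) hn
  have h9 : ∀ n : ℤ, 695 < n → ∃ x₁ x₂ x₃ x₄ : ℕ, n = polygonalNumber 9 x₁ + polygonalNumber 9 x₂
      + polygonalNumber 9 x₃ + 3 * polygonalNumber 9 x₄ := fun n hn =>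
    exists_nat_of_gt (m := 7) (M := 695) (by norm_num) (by norm_num) (by decide +kernel) hn
  have h10 : ∀ n : ℤ, 916 < n → ∃ x₁ x₂ x₃ x₄ : ℕ, n = polygonalNumber 10 x₁
      + polygonalNumber 10 x₂ + polygonalNumber 10 x₃ + 3 * polygonalNumber 10 x₄ := fun n hn =>
    exists_nat_of_gt (m := 8) (M := 916) (by norm_num) (by norm_num) (by decide +kernel) hn
  have h7 : CoversBelow 60000 [13, 16, 27, 31, 33, 49, 50, 67, 87, 178, 181, 259]
      (quaternaryMask (polygonalList 5) (polygonalList 5)) := by decide +kernel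
  -- One argument in ℤ repairs every exception of the heptagonal case, which is all that the mixed
  -- statement needs beyond `h7`.
  have h7' : ∀ e ∈ [13, 16, 27, 31, 33, 49, 50, 67, 87, 178, 181, 259],
      (quaternaryMask (generalizedPolygonalList 5) (polygonalList 5)).testBit e = true := by
    decide +kernel
  refine ⟨?_, ?_, ?_, h8, h9, h10, ?_, ?_, ?_⟩
  · refine (setOf_nat_eq (m := 3) [19] (by norm_num) (by norm_num) (by decide +kernel)
      (by decide +kernel)).trans
      (congrArg (Set.range (Nat.cast : ℕ → ℤ) \ ·) ?_)
    ext z; simp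
  · refine (setOf_nat_eq (m := 4) [14, 23, 41, 42, 83] (by norm_num) (by norm_num)
      (by decide +kernel) (by decide +kernel)).trans
      (congrArg (Set.range (Nat.cast : ℕ → ℤ) \ ·) ?_)
    ext z; simp
  · refine (setOf_nat_eq (m := 5) _ (by norm_num) (by norm_num) h7 (by decide +kernel)).trans
      (congrArg (Set.range (Nat.cast : ℕ → ℤ) \ ·) ?_)
    ext z; simp
  · ext n
    constructor
    · rintro ⟨w, x, y, z, h⟩
      obtain ⟨k, rfl⟩ := Int.eq_ofNat_of_zero_le (nonneg_of_eq (m := 5) (by norm_num) h)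
      exact ⟨k, rfl⟩
    · rintro ⟨k, rfl⟩
      by_cases hk : k ∈ [13, 16, 27, 31, 33, 49, 50, 67, 87, 178, 181, 259]
      · exact exists_int_nat_of_testBit (by norm_num) (h7' k hk)
      · obtain ⟨x₁, x₂, x₃, x₄, h⟩ :=
          exists_nat_of_coversBelow (by norm_num) (by norm_num) h7 hk
        exact ⟨x₁, x₂, x₃, x₄, h⟩
  · refine (setOf_int_eq (m := 7) (M := 695) [17] (by norm_num) h9 (by decide +kernel)
      (by decide +kernel)).trans
      (congrArg (Set.range (Nat.cast : ℕ → ℤ) \ ·) ?_)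
    ext z; simp
  · refine (setOf_int_eq (m := 8) (M := 916) [16, 19] (by norm_num) h10 (by decide +kernel)
      (by decide +kernel)).trans
      (congrArg (Set.range (Nat.cast : ℕ → ℤ) \ ·) ?_)
    ext z; simp
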